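/- Let $c$ be a positive integer and let $\hbar,\mu,\nu\in\mathbb R$ with $\mu^2+\nu^2\neq0$. Write $e(t)=e^{2\pi i t}$ and $\mathbb T=\mathbb R/\mathbb Z$. Let $S^c$ be the space of $C^\infty$ functions $\Phi:\mathbb R\times\mathbb T\times\mathbb Z\to\mathbb C$ such that (a) $\Phi(x+k,y,p)=e(ckpy)\,\Phi(x,y,p)$ for all $k\in\mathbb Z$; (b) for every polynomial $P$, all integers $m,n\ge0$ and every compact $K\subset\mathbb R\times\mathbb T$, the function $P(p)\,\frac{\partial^{m+n}\Phi}{\partial x^m\partial y^n}(x,y,p)$ is bounded on $K\times\mathbb Z$. Let $\Phi^*(x,y,p)=\overline{\Phi(x,y,-p)}$ and let $A=\{\phi\in S^c:\phi^*=\phi\}$, a real vector space containing the element $I(x,y,p)=\delta_{p,0}$. For $\Phi\in S^c$ let $\pi(\Phi)$ be the bounded operator on $L^2(\mathbb R\times\mathbb T\times\mathbb Z)$ given by $$(\pi(\Phi)\xi)(x,y,p)=\sum_{q\in\mathbb Z}\Phi\bigl(x-\hbar(q-2p)\mu,\;y-\hbar(q-2p)\nu,\;q\bigr)\,\xi(x,y,p-q)$$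 (the norm closure of $\pi(S^c)$ is the quantum Heisenberg manifold). Order $A$ as a subspace of this C*-algebra: $\phi\le\psi$ iff $\pi(\psi)-\pi(\phi)$ is a positive operator. For a function $\Phi$ on $\mathbb R\times\mathbb T\times\mathbb Z$ put $\|\Phi\|_{\infty,\infty,1}=\sum_{p\in\mathbb Z}\sup_{x\in\mathbb R,\,y\in\mathbb T}|\Phi(x,y,p)|$, and let $$\delta_1\phi=-\frac{\partial\phi}{\partial x},\qquad \delta_2\phi=2\pi i c\,p\,x\,\phi-\frac{\partial\phi}{\partial y},\qquad \delta_3\phi=2\pi i\,p\,\phi$$ be the derivations of $S^c$ coming from the Heisenberg group action. For $\phi\in A$ let $L(\phi)=\max_{i=1,2,3}\|\delta_i\phi\|_{\infty,\infty,1}$, a finite seminorm on $A$. **Theorem.** $((A,I),L)$ is a compact quantum metric space, that is: 1. $(A,\le,I)$ is an order unit space: it is a real partially ordered vector space, for each $a\in A$ there is $r\in\mathbb R$ with $a\le rI$, and if $a\le rI$ for all real $r>0$ then $a\le0$. 2. $L$ is a Lip norm: for $a\in A$, $L(a)=0$ iff $a\in\mathbb R I$; and on the state space $S(A)$, which consists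 of the linear functionals $f:A\to\mathbb R$ with $f(I)=1$ that are bounded with dual norm $1$ for the order unit norm $\|a\|=\inf\{r\in\mathbb R:-rI\le a\le rI\}$, the formula $$\rho_L(f,g)=\sup\{|f(a)-g(a)|:a\in A,\ L(a)\le1\}$$ defines a (finite) metric whose topology is the w*-topology (the topology of pointwise convergence on $A$). -/

import Mathlib

open MeasureTheory
open scoped ContDiff ComplexConjugate ENNReal

noncomputable section

/-! ### Order unit spaces, states, Lip norms -/

section OrderUnit

variable {A : Type*} [AddCommGroup A] [Module ℝ A]

/-- `(A, le, e)` is an order unit space: a real partially ordered vector space with an order unit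
`e` satisfying the order unit property and the Archimedean property. -/
structure IsOrderUnitSpace (le : A → A → Prop) (e : A) : Prop where
  refl : ∀ a, le a a
  trans : ∀ a b d, le a b → le b d → le a d
  antisymm : ∀ a b, le a b → le b a → a = b
  add_right : ∀ a b d, le a b → le (a + d) (b + d)
  smul_nonneg : ∀ (r : ℝ) (a b : A), 0 ≤ r → le a b → le (r • a) (r • b)
  order_unit : ∀ a, ∃ r : ℝ, le a (r • e)
  archimedean : ∀ a, (∀ r : ℝ, 0 < r → le a (r • e)) → le a 0

/-- The order unit norm `‖a‖ = inf {r | -r e ≤ a ≤ r e}`. -/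
def orderUnitNorm (le : A → A → Prop) (e : A) (a : A) : ℝ :=
  sInf {r : ℝ | le ((-r) • e) a ∧ le a (r • e)}

/-- A state: a linear functional `f` with `f e = 1` that is bounded for the order unit norm, with
dual norm equal to `1`. -/
structure OrderUnitState (le : A → A → Prop) (e : A) where
  toFun : A →ₗ[ℝ] ℝ
  map_unit : toFun e = 1
  dual_norm : IsLUB {t : ℝ | ∃ a, orderUnitNorm le e a ≤ 1 ∧ t = |toFun a|} 1

/-- The w*-topology on the state space: the topology of pointwise convergence on `A`. -/
abbrev weakStarTopology (le : A → A → Prop) (e : A) : TopologicalSpace (OrderUnitState le e) :=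
  TopologicalSpace.induced (fun (f : OrderUnitState le e) (a : A) => f.toFun a) inferInstance

/-- A Lip norm: a seminorm vanishing exactly on the multiples of the order unit, such that
`ρ_L (f, g) = sup {|f a - g a| : L a ≤ 1}` is a (finite) metric on the state space, whose topology
is the w*-topology. -/
structure IsLipNorm (le : A → A → Prop) (e : A) (L : Seminorm ℝ A) : Prop where
  eq_zero_iff : ∀ a, L a = 0 ↔ ∃ r : ℝ, a = r • e
  metrizes : ∃ d : MetricSpace (OrderUnitState le e),
    (∀ f g : OrderUnitState le e,
      IsLUB {t : ℝ | ∃ a, L a ≤ 1 ∧ t = |f.toFun a - g.toFun a|} (d.dist f g)) ∧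
    d.toPseudoMetricSpace.toUniformSpace.toTopologicalSpace = weakStarTopology le e

/-- A compact quantum metric space: an order unit space with a Lip norm. -/
structure IsCompactQuantumMetricSpace (le : A → A → Prop) (e : A) (L : Seminorm ℝ A) : Prop where
  orderUnitSpace : IsOrderUnitSpace le e
  lipNorm : IsLipNorm le e L

end OrderUnit

/-! ### The space `S^c` of functions on `ℝ × 𝕋 × ℤ` -/

namespace QHM

/-- `ℝ × 𝕋 × ℤ`, with `𝕋 = ℝ / ℤ`. -/
abbrev Pt : Type := ℝ × UnitAddCircle × ℤ

/-- The slice of `Φ` at `p`, pulled back from `ℝ × 𝕋` to `ℝ × ℝ`. -/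
def lift (Φ : Pt → ℂ) (p : ℤ) (z : ℝ × ℝ) : ℂ := Φ (z.1, (z.2 : UnitAddCircle), p)

/-- Smoothness on `ℝ × 𝕋 × ℤ`. -/
def IsSmooth (Φ : Pt → ℂ) : Prop := ∀ p, ContDiff ℝ ∞ (lift Φ p)

/-- `∂Φ/∂x`. -/
def dx (Φ : Pt → ℂ) : Pt → ℂ := fun z =>
  deriv (fun s : ℝ => Φ (z.1 + s, z.2.1, z.2.2)) 0

/-- `∂Φ/∂y`. -/
def dy (Φ : Pt → ℂ) : Pt → ℂ := fun z =>
  deriv (fun s : ℝ => Φ (z.1, z.2.1 + (s : UnitAddCircle), z.2.2)) 0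

/-- Membership in `S^c`. Here `fourier n y = e(n y)` for `y ∈ 𝕋`. -/
structure MemS (c : ℕ) (Φ : Pt → ℂ) : Prop where
  smooth : IsSmooth Φ
  quasi : ∀ (k : ℤ) (x : ℝ) (y : UnitAddCircle) (p : ℤ),
    Φ (x + k, y, p) = fourier ((c : ℤ) * k * p) y * Φ (x, y, p)
  decay : ∀ (P : Polynomial ℂ) (m n : ℕ) (K : Set (ℝ × UnitAddCircle)), IsCompact K →
    ∃ C : ℝ, ∀ w ∈ K, ∀ p : ℤ, ‖P.eval (p : ℂ) * (dx^[m] (dy^[n] Φ)) (w.1, w.2, p)‖ ≤ C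

lemma dx_lift {Φ : Pt → ℂ} (h : IsSmooth Φ) (p : ℤ) (z : ℝ × ℝ) :
    lift (dx Φ) p z = fderiv ℝ (lift Φ p) z (1, 0) := by
  rw [← ((h p).differentiable (by simp) z).lineDeriv_eq_fderiv]
  simp [lift, dx, lineDeriv]

lemma dy_lift {Φ : Pt → ℂ} (h : IsSmooth Φ) (p : ℤ) (z : ℝ × ℝ) :
    lift (dy Φ) p z = fderiv ℝ (lift Φ p) z (0, 1) := by
  rw [← ((h p).differentiable (by simp) z).lineDeriv_eq_fderiv]
  simp [lift, dy, lineDeriv]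

lemma IsSmooth.dx {Φ : Pt → ℂ} (h : IsSmooth Φ) : IsSmooth (dx Φ) := fun p => by
  have : lift (QHM.dx Φ) p = fun z => fderiv ℝ (lift Φ p) z (1, 0) := funext (dx_lift h p)
  rw [this]
  exact ((h p).fderiv_right (by simp)).clm_apply contDiff_const

lemma IsSmooth.dy {Φ : Pt → ℂ} (h : IsSmooth Φ) : IsSmooth (dy Φ) := fun p => by
  have : lift (QHM.dy Φ) p = fun z => fderiv ℝ (lift Φ p) z (0, 1) := funext (dy_lift h p)
  rw [this]
  exact ((h p).fderiv_right (by simp)).clm_apply contDiff_const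

lemma IsSmooth.dx_iter {Φ : Pt → ℂ} (h : IsSmooth Φ) (m : ℕ) : IsSmooth (QHM.dx^[m] Φ) := by
  induction m with
  | zero => exact h
  | succ m ih => rw [Function.iterate_succ_apply']; exact ih.dx

lemma IsSmooth.dy_iter {Φ : Pt → ℂ} (h : IsSmooth Φ) (m : ℕ) : IsSmooth (QHM.dy^[m] Φ) := by
  induction m with
  | zero => exact h
  | succ m ih => rw [Function.iterate_succ_apply']; exact ih.dy

lemma IsSmooth.add {Φ Ψ : Pt → ℂ} (h : IsSmooth Φ) (h' : IsSmooth Ψ) : IsSmooth (Φ + Ψ) :=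
  fun p => (h p).add (h' p)

lemma IsSmooth.smul {Φ : Pt → ℂ} (a : ℂ) (h : IsSmooth Φ) : IsSmooth (a • Φ) :=
  fun p => contDiff_const.smul (h p)

lemma dx_add {Φ Ψ : Pt → ℂ} (h : IsSmooth Φ) (h' : IsSmooth Ψ) : dx (Φ + Ψ) = dx Φ + dx Ψ := by
  ext ⟨x, y, p⟩
  obtain ⟨t, rfl⟩ := QuotientAddGroup.mk_surjective y
  change lift (dx (Φ + Ψ)) p (x, t) = lift (dx Φ) p (x, t) + lift (dx Ψ) p (x, t)
  rw [dx_lift (h.add h'), dx_lift h, dx_lift h']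
  have : lift (Φ + Ψ) p = lift Φ p + lift Ψ p := rfl
  rw [this, fderiv_add ((h p).differentiable (by simp) _) ((h' p).differentiable (by simp) _)]
  rfl

lemma dy_add {Φ Ψ : Pt → ℂ} (h : IsSmooth Φ) (h' : IsSmooth Ψ) : dy (Φ + Ψ) = dy Φ + dy Ψ := by
  ext ⟨x, y, p⟩
  obtain ⟨t, rfl⟩ := QuotientAddGroup.mk_surjective y
  change lift (dy (Φ + Ψ)) p (x, t) = lift (dy Φ) p (x, t) + lift (dy Ψ) p (x, t)
  rw [dy_lift (h.add h'), dy_lift h, dy_lift h']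
  have : lift (Φ + Ψ) p = lift Φ p + lift Ψ p := rfl
  rw [this, fderiv_add ((h p).differentiable (by simp) _) ((h' p).differentiable (by simp) _)]
  rfl

lemma dx_smul (a : ℂ) (Φ : Pt → ℂ) : dx (a • Φ) = a • dx Φ := by
  ext z
  simp [dx]

lemma dy_smul (a : ℂ) (Φ : Pt → ℂ) : dy (a • Φ) = a • dy Φ := by
  ext z
  simp [dy]

lemma iter_add {Φ Ψ : Pt → ℂ} (h : IsSmooth Φ) (h' : IsSmooth Ψ) (m n : ℕ) :
    dx^[m] (dy^[n] (Φ + Ψ)) = dx^[m] (dy^[n] Φ) + dx^[m] (dy^[n] Ψ) := by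
  have h1 : dy^[n] (Φ + Ψ) = dy^[n] Φ + dy^[n] Ψ := by
    induction n with
    | zero => rfl
    | succ n ih =>
      simp only [Function.iterate_succ_apply', ih]
      exact dy_add (h.dy_iter n) (h'.dy_iter n)
  rw [h1]
  induction m with
  | zero => rfl
  | succ m ih =>
    simp only [Function.iterate_succ_apply', ih]
    exact dx_add ((h.dy_iter n).dx_iter m) ((h'.dy_iter n).dx_iter m)

lemma iter_smul (a : ℂ) (Φ : Pt → ℂ) (m n : ℕ) :
    dx^[m] (dy^[n] (a • Φ)) = a • dx^[m] (dy^[n] Φ) := by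
  have h1 : dy^[n] (a • Φ) = a • dy^[n] Φ := by
    induction n with
    | zero => rfl
    | succ n ih => simp only [Function.iterate_succ_apply', ih, dy_smul]
  rw [h1]
  induction m with
  | zero => rfl
  | succ m ih => simp only [Function.iterate_succ_apply', ih, dx_smul]

/-- The vector space `S^c`. -/
def Sc (c : ℕ) : Submodule ℂ (Pt → ℂ) where
  carrier := {Φ | MemS c Φ}
  zero_mem' := by
    have h0 : ∀ m n, dx^[m] (dy^[n] (0 : Pt → ℂ)) = 0 := fun m n => by
      simpa using iter_smul 0 0 m n
    exact ⟨fun p => contDiff_const (c := (0 : ℂ)), fun k x y p => by simp,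
      fun P m n K _ => ⟨0, fun w _ p => by simp [h0]⟩⟩
  add_mem' := by
    intro Φ Ψ h h'
    refine ⟨h.smooth.add h'.smooth, fun k x y p => ?_, fun P m n K hK => ?_⟩
    · simp only [Pi.add_apply, h.quasi, h'.quasi, mul_add]
    · obtain ⟨C, hC⟩ := h.decay P m n K hK
      obtain ⟨C', hC'⟩ := h'.decay P m n K hK
      refine ⟨C + C', fun w hw p => ?_⟩
      rw [iter_add h.smooth h'.smooth, Pi.add_apply, mul_add]
      exact (norm_add_le _ _).trans (add_le_add (hC w hw p) (hC' w hw p))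
  smul_mem' := by
    intro a Φ h
    refine ⟨h.smooth.smul a, fun k x y p => ?_, fun P m n K hK => ?_⟩
    · simp only [Pi.smul_apply, h.quasi, smul_eq_mul]; ring
    · obtain ⟨C, hC⟩ := h.decay P m n K hK
      refine ⟨‖a‖ * C, fun w hw p => ?_⟩
      rw [iter_smul, Pi.smul_apply, smul_eq_mul, mul_left_comm, norm_mul]
      exact mul_le_mul_of_nonneg_left (hC w hw p) (norm_nonneg _)

/-- The involution `Φ* (x, y, p) = conj Φ (x, y, -p)`. -/
def invol (Φ : Pt → ℂ) : Pt → ℂ := fun z => conj (Φ (z.1, z.2.1, -z.2.2))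

/-- The real vector space of self-adjoint elements of `S^c`. -/
def saPart (c : ℕ) : Submodule ℝ (Sc c) where
  carrier := {φ | invol φ = φ}
  zero_mem' := by ext z; simp [invol]
  add_mem' := by
    intro φ ψ h h'
    have h : invol φ = φ := h
    have h' : invol ψ = ψ := h'
    ext z
    have e1 := congrFun h z
    have e2 := congrFun h' z
    simp only [invol] at e1 e2
    simp [invol, e1, e2]
  smul_mem' := by
    intro r φ h
    have h : invol φ = φ := h
    ext z
    have e1 := congrFun h z
    simp only [invol] at e1
    simp [invol, e1]

/-- The unit `I (x, y, p) = δ_{p 0}`. -/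
def unitFun : Pt → ℂ := fun z => if z.2.2 = 0 then 1 else 0

lemma dx_unitFun : dx unitFun = 0 := by ext z; exact deriv_const (0 : ℝ) (unitFun z)

lemma dy_unitFun : dy unitFun = 0 := by ext z; exact deriv_const (0 : ℝ) (unitFun z)

lemma unitFun_mem (c : ℕ) : unitFun ∈ Sc c := by
  refine ⟨fun p => contDiff_const (c := if p = 0 then (1 : ℂ) else 0), fun k x y p => ?_,
    fun P m n K _ => ?_⟩
  · by_cases hp : p = 0 <;> simp [unitFun, hp]
  · have h0 : ∀ m n, dx^[m] (dy^[n] (0 : Pt → ℂ)) = 0 := fun m n => by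
      simpa using iter_smul 0 0 m n
    rcases n with _ | n
    · rcases m with _ | m
      · refine ⟨‖P.eval 0‖, fun w _ p => ?_⟩
        by_cases hp : p = 0 <;> simp [unitFun, hp]
      · refine ⟨0, fun w _ p => ?_⟩
        have := h0 m 0
        simp only [Function.iterate_zero, id] at this
        simp [Function.iterate_succ_apply, dx_unitFun, this]
    · refine ⟨0, fun w _ p => ?_⟩
      simp [Function.iterate_succ_apply, dy_unitFun, h0]

/-- The order unit `I` as an element of the self-adjoint part. -/
def unit (c : ℕ) : saPart c :=
  ⟨⟨unitFun, unitFun_mem c⟩, by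
    change invol unitFun = unitFun
    ext z
    by_cases hp : z.2.2 = 0 <;> simp [invol, unitFun, hp]⟩

/-! ### The norm `‖·‖_{∞,∞,1}`, the derivations and the seminorm `L` -/

/-- `sup_{x ∈ ℝ, y ∈ 𝕋} |Φ (x, y, p)|`. -/
def supSlice (Φ : Pt → ℂ) (p : ℤ) : ℝ := ⨆ w : ℝ × UnitAddCircle, ‖Φ (w.1, w.2, p)‖

/-- `‖Φ‖_{∞,∞,1} = ∑_p sup_{x, y} |Φ (x, y, p)|`. -/
def norm1 (Φ : Pt → ℂ) : ℝ := ∑' p : ℤ, supSlice Φ p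

def delta1 (Φ : Pt → ℂ) : Pt → ℂ := fun z => -dx Φ z

def delta2 (c : ℕ) (Φ : Pt → ℂ) : Pt → ℂ := fun z =>
  2 * Real.pi * Complex.I * c * z.2.2 * z.1 * Φ z - dy Φ z

def delta3 (Φ : Pt → ℂ) : Pt → ℂ := fun z => 2 * Real.pi * Complex.I * z.2.2 * Φ z

/-- Auxiliary: a bound that makes all the suprema and the sum in `norm1` finite. -/
def Rapid (Φ : Pt → ℂ) : Prop := ∃ C : ℝ, ∀ (x : ℝ) (y : UnitAddCircle) (p : ℤ),
  (1 + (p : ℝ) ^ 2) * ‖Φ (x, y, p)‖ ≤ C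

lemma Rapid.add {Φ Ψ : Pt → ℂ} (h : Rapid Φ) (h' : Rapid Ψ) : Rapid (Φ + Ψ) := by
  obtain ⟨C, hC⟩ := h
  obtain ⟨C', hC'⟩ := h'
  refine ⟨C + C', fun x y p => ?_⟩
  calc _ ≤ (1 + (p : ℝ) ^ 2) * (‖Φ (x, y, p)‖ + ‖Ψ (x, y, p)‖) := by
        gcongr; exact norm_add_le _ _
    _ ≤ _ := by rw [mul_add]; exact add_le_add (hC x y p) (hC' x y p)

lemma Rapid.bdd {Φ : Pt → ℂ} (h : Rapid Φ) (p : ℤ) :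
    BddAbove (Set.range fun w : ℝ × UnitAddCircle => ‖Φ (w.1, w.2, p)‖) := by
  obtain ⟨C, hC⟩ := h
  refine ⟨C, ?_⟩
  rintro _ ⟨w, rfl⟩
  have := hC w.1 w.2 p
  have h2 : 0 ≤ (p : ℝ) ^ 2 * ‖Φ (w.1, w.2, p)‖ := by positivity
  simp only
  linarith

lemma Rapid.le_supSlice {Φ : Pt → ℂ} (h : Rapid Φ) (x : ℝ) (y : UnitAddCircle) (p : ℤ) :
    ‖Φ (x, y, p)‖ ≤ supSlice Φ p := le_ciSup (h.bdd p) (x, y)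

lemma supSlice_nonneg (Φ : Pt → ℂ) (p : ℤ) : 0 ≤ supSlice Φ p :=
  Real.iSup_nonneg fun _ => norm_nonneg _

lemma Rapid.summable {Φ : Pt → ℂ} (h : Rapid Φ) : Summable (supSlice Φ) := by
  obtain ⟨C, hC⟩ := h
  have hs : Summable fun p : ℤ => C * (1 / (1 + (p : ℝ) ^ 2)) := by
    apply Summable.mul_left
    refine Summable.of_norm_bounded_eventually (g := fun p : ℤ => 1 / (p : ℝ) ^ 2)
      (Real.summable_one_div_int_pow.mpr one_lt_two) ?_
    have : ({0}ᶜ : Set ℤ) ∈ Filter.cofinite := (Set.finite_singleton 0).compl_mem_cofinite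
    filter_upwards [this] with p hp
    have hp' : (0 : ℝ) < (p : ℝ) ^ 2 := by
      have : (p : ℝ) ≠ 0 := by exact_mod_cast hp
      positivity
    rw [Real.norm_of_nonneg (by positivity)]
    gcongr
    linarith
  refine Summable.of_nonneg_of_le (supSlice_nonneg Φ) (fun p => ?_) hs
  refine ciSup_le fun w => ?_
  rw [mul_one_div, le_div_iff₀ (by positivity), mul_comm]
  exact hC w.1 w.2 p

lemma norm1_nonneg (Φ : Pt → ℂ) : 0 ≤ norm1 Φ := tsum_nonneg (supSlice_nonneg Φ)

lemma norm1_add {Φ Ψ : Pt → ℂ} (h : Rapid Φ) (h' : Rapid Ψ) :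
    norm1 (Φ + Ψ) ≤ norm1 Φ + norm1 Ψ := by
  rw [norm1, norm1, norm1, ← h.summable.tsum_add h'.summable]
  refine (h.add h').summable.tsum_le_tsum (fun p => ?_) (h.summable.add h'.summable)
  refine ciSup_le fun w => (norm_add_le _ _).trans ?_
  exact add_le_add (h.le_supSlice _ _ _) (h'.le_supSlice _ _ _)

lemma norm1_smul (r : ℝ) (Φ : Pt → ℂ) : norm1 ((r : ℂ) • Φ) = ‖r‖ * norm1 Φ := by
  rw [norm1, norm1, ← tsum_mul_left]
  congr 1
  ext p
  simp only [supSlice, Pi.smul_apply, smul_eq_mul, norm_mul, Complex.norm_real]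
  rw [Real.mul_iSup_of_nonneg (norm_nonneg _)]

/-- Decay on the fundamental domain `0 ≤ x ≤ 1`. -/
lemma MemS.decay_unit {c : ℕ} {Φ : Pt → ℂ} (h : MemS c Φ) (P : Polynomial ℂ) (m n : ℕ) :
    ∃ C : ℝ, ∀ x ∈ Set.Icc (0 : ℝ) 1, ∀ (y : UnitAddCircle) (p : ℤ),
      ‖P.eval (p : ℂ)‖ * ‖(dx^[m] (dy^[n] Φ)) (x, y, p)‖ ≤ C := by
  obtain ⟨C, hC⟩ := h.decay P m n (Set.Icc 0 1 ×ˢ Set.univ) (isCompact_Icc.prod isCompact_univ)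
  exact ⟨C, fun x hx y p => by simpa only [norm_mul] using hC (x, y) ⟨hx, trivial⟩ p⟩

lemma rapid_of_unit {G : Pt → ℂ}
    (hper : ∀ (k : ℤ) (x : ℝ) (y : UnitAddCircle) (p : ℤ), ‖G (x + k, y, p)‖ = ‖G (x, y, p)‖)
    (C : ℝ) (hC : ∀ x ∈ Set.Icc (0 : ℝ) 1, ∀ (y : UnitAddCircle) (p : ℤ), (1 + (p : ℝ) ^ 2) * ‖G (x, y, p)‖ ≤ C) :
    Rapid G := by
  refine ⟨C, fun x y p => ?_⟩
  have := hper ⌊x⌋ (Int.fract x) y p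
  rw [Int.fract_add_floor] at this
  rw [this]
  exact hC _ ⟨Int.fract_nonneg x, (Int.fract_lt_one x).le⟩ y p

lemma norm_fourier (n : ℤ) (y : UnitAddCircle) : ‖(fourier n y : ℂ)‖ = 1 := by
  rw [fourier_apply]; exact Circle.norm_coe _

lemma eval_weight (p : ℤ) :
    ‖(Polynomial.C 1 + Polynomial.X ^ 2 : Polynomial ℂ).eval (p : ℂ)‖ = 1 + (p : ℝ) ^ 2 := by
  have : (Polynomial.C 1 + Polynomial.X ^ 2 : Polynomial ℂ).eval (p : ℂ)
      = ((1 + (p : ℝ) ^ 2 : ℝ) : ℂ) := by simp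
  rw [this, Complex.norm_real, Real.norm_of_nonneg (by positivity)]

lemma MemS.rapid {c : ℕ} {Φ : Pt → ℂ} (h : MemS c Φ) : Rapid Φ := by
  obtain ⟨C, hC⟩ := h.decay_unit (Polynomial.C 1 + Polynomial.X ^ 2) 0 0
  refine rapid_of_unit (fun k x y p => by rw [h.quasi, norm_mul, norm_fourier, one_mul]) C ?_
  intro x hx y p
  simpa only [eval_weight, Function.iterate_zero, id] using hC x hx y p

lemma MemS.rapid_delta1 {c : ℕ} {Φ : Pt → ℂ} (h : MemS c Φ) : Rapid (delta1 Φ) := by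
  obtain ⟨C, hC⟩ := h.decay_unit (Polynomial.C 1 + Polynomial.X ^ 2) 1 0
  refine rapid_of_unit (fun k x y p => ?_) C ?_
  · have : dx Φ (x + k, y, p) = fourier ((c : ℤ) * k * p) y * dx Φ (x, y, p) := by
      simp only [dx]
      rw [← deriv_const_mul_field]
      congr 1
      ext s
      rw [← h.quasi, add_right_comm]
    simp only [delta1, norm_neg, this, norm_mul, norm_fourier, one_mul]
  · intro x hx y p
    simpa only [eval_weight, delta1, norm_neg, Function.iterate_zero, Function.iterate_one, id] using hC x hx y p

lemma MemS.rapid_delta3 {c : ℕ} {Φ : Pt → ℂ} (h : MemS c Φ) : Rapid (delta3 Φ) := by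
  obtain ⟨C, hC⟩ := h.decay_unit
    ((Polynomial.C 1 + Polynomial.X ^ 2) *
      (Polynomial.C (2 * Real.pi * Complex.I) * Polynomial.X)) 0 0
  refine rapid_of_unit (fun k x y p => by
    simp only [delta3, h.quasi, norm_mul, norm_fourier, one_mul]) C ?_
  intro x hx y p
  have := hC x hx y p
  rw [Polynomial.eval_mul, norm_mul, eval_weight, mul_assoc, ← norm_mul] at this
  simpa only [delta3, Polynomial.eval_mul, Polynomial.eval_C, Polynomial.eval_X,
    Function.iterate_zero, id] using this

lemma MemS.dy_quasi {c : ℕ} {Φ : Pt → ℂ} (h : MemS c Φ) (k : ℤ) (x : ℝ) (y : UnitAddCircle)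
    (p : ℤ) : dy Φ (x + k, y, p) = fourier ((c : ℤ) * k * p) y *
      (2 * Real.pi * Complex.I * c * p * k * Φ (x, y, p) + dy Φ (x, y, p)) := by
  obtain ⟨t, rfl⟩ := QuotientAddGroup.mk_surjective y
  have hd : DifferentiableAt ℝ (fun s : ℝ => Φ (x, ((t : ℝ) : UnitAddCircle) + ((s : ℝ) : UnitAddCircle), p)) 0 := by
    have h1 : DifferentiableAt ℝ (fun s : ℝ => lift Φ p (x, t + s)) 0 :=
      ((h.smooth p).differentiable (by simp) _).comp (0 : ℝ) (by fun_prop)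
    simpa [lift] using h1
  have hf : HasDerivAt (fun s : ℝ => (fourier ((c : ℤ) * k * p)
      (((t : ℝ) : UnitAddCircle) + ((s : ℝ) : UnitAddCircle)) : ℂ))
      (2 * Real.pi * Complex.I * ((c : ℤ) * k * p : ℤ) / (1 : ℝ) *
        fourier ((c : ℤ) * k * p) (t : UnitAddCircle)) 0 := by
    have h1 := hasDerivAt_fourier 1 ((c : ℤ) * k * p) (t + 0)
    have h2 := h1.comp_const_add t 0
    simpa using h2
  have := (hf.mul hd.hasDerivAt).deriv
  have e : (fun s : ℝ => Φ (x + k, ((t : ℝ) : UnitAddCircle) + ((s : ℝ) : UnitAddCircle), p)) =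
      (fun s : ℝ => (fourier ((c : ℤ) * k * p)
      (((t : ℝ) : UnitAddCircle) + ((s : ℝ) : UnitAddCircle)) : ℂ)) *
      (fun s : ℝ => Φ (x, ((t : ℝ) : UnitAddCircle) + ((s : ℝ) : UnitAddCircle), p)) := by
    ext s; exact h.quasi _ _ _ _
  change deriv (fun s : ℝ => Φ (x + k, ((t : ℝ) : UnitAddCircle) + ((s : ℝ) : UnitAddCircle), p)) 0 = _
  rw [e, this]
  simp only [dy, QuotientAddGroup.mk_zero, add_zero]
  push_cast
  simp only [div_one]
  ring

lemma MemS.rapid_delta2 {c : ℕ} {Φ : Pt → ℂ} (h : MemS c Φ) : Rapid (delta2 c Φ) := by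
  obtain ⟨C, hC⟩ := h.decay_unit
    ((Polynomial.C 1 + Polynomial.X ^ 2) *
      (Polynomial.C (2 * Real.pi * Complex.I * c) * Polynomial.X)) 0 0
  obtain ⟨C', hC'⟩ := h.decay_unit (Polynomial.C 1 + Polynomial.X ^ 2) 0 1
  refine rapid_of_unit (fun k x y p => ?_) (C + C') ?_
  · have : delta2 c Φ (x + k, y, p) = fourier ((c : ℤ) * k * p) y * delta2 c Φ (x, y, p) := by
      simp only [delta2, h.quasi, h.dy_quasi]
      push_cast
      ring
    rw [this, norm_mul, norm_fourier, one_mul]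
  · intro x hx y p
    have h1 := hC x hx y p
    have h2 := hC' x hx y p
    rw [Polynomial.eval_mul, norm_mul, eval_weight, mul_assoc, ← norm_mul] at h1
    simp only [Polynomial.eval_mul, Polynomial.eval_C, Polynomial.eval_X,
      Function.iterate_zero, id] at h1
    rw [eval_weight] at h2
    simp only [Function.iterate_one, Function.iterate_zero, id] at h2
    have h3 : ‖delta2 c Φ (x, y, p)‖ ≤
        ‖2 * Real.pi * Complex.I * c * p * Φ (x, y, p)‖ + ‖dy Φ (x, y, p)‖ := by
      refine (norm_sub_le _ _).trans (add_le_add ?_ le_rfl)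
      have hx1 : ‖(x : ℂ)‖ ≤ 1 := by
        rw [Complex.norm_real, Real.norm_of_nonneg hx.1]; exact hx.2
      have e : 2 * Real.pi * Complex.I * c * p * x * Φ (x, y, p) =
          x * (2 * Real.pi * Complex.I * c * p * Φ (x, y, p)) := by ring
      simp only
      rw [e, norm_mul]
      exact mul_le_of_le_one_left (norm_nonneg _) hx1
    calc _ ≤ (1 + (p : ℝ) ^ 2) *
          (‖2 * Real.pi * Complex.I * c * p * Φ (x, y, p)‖ + ‖dy Φ (x, y, p)‖) := by gcongr
      _ ≤ _ := by rw [mul_add]; exact add_le_add h1 h2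

lemma delta1_add {Φ Ψ : Pt → ℂ} (h : IsSmooth Φ) (h' : IsSmooth Ψ) :
    delta1 (Φ + Ψ) = delta1 Φ + delta1 Ψ := by
  ext z; simp only [delta1, dx_add h h', Pi.add_apply]; ring

lemma delta2_add (c : ℕ) {Φ Ψ : Pt → ℂ} (h : IsSmooth Φ) (h' : IsSmooth Ψ) :
    delta2 c (Φ + Ψ) = delta2 c Φ + delta2 c Ψ := by
  ext z; simp only [delta2, dy_add h h', Pi.add_apply]; ring

lemma delta3_add (Φ Ψ : Pt → ℂ) : delta3 (Φ + Ψ) = delta3 Φ + delta3 Ψ := by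
  ext z; simp only [delta3, Pi.add_apply]; ring

lemma delta1_smul (a : ℂ) (Φ : Pt → ℂ) : delta1 (a • Φ) = a • delta1 Φ := by
  ext z; simp [delta1, dx_smul]

lemma delta2_smul (c : ℕ) (a : ℂ) (Φ : Pt → ℂ) : delta2 c (a • Φ) = a • delta2 c Φ := by
  ext z; simp only [delta2, dy_smul, Pi.smul_apply, smul_eq_mul]; ring

lemma delta3_smul (a : ℂ) (Φ : Pt → ℂ) : delta3 (a • Φ) = a • delta3 Φ := by
  ext z; simp only [delta3, Pi.smul_apply, smul_eq_mul]; ring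

/-- `L φ = max_{i = 1, 2, 3} ‖δ_i φ‖_{∞,∞,1}`, a seminorm on the self-adjoint part of `S^c`. -/
def lipL (c : ℕ) : Seminorm ℝ (saPart c) :=
  Seminorm.of
    (fun φ => max (max (norm1 (delta1 (φ : Sc c))) (norm1 (delta2 c (φ : Sc c))))
      (norm1 (delta3 (φ : Sc c))))
    (by
      rintro ⟨⟨φ, hφ⟩, -⟩ ⟨⟨ψ, hψ⟩, -⟩
      have hφ : MemS c φ := hφ
      have hψ : MemS c ψ := hψ
      have h1 := norm1_add hφ.rapid_delta1 hψ.rapid_delta1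
      have h2 := norm1_add hφ.rapid_delta2 hψ.rapid_delta2
      have h3 := norm1_add hφ.rapid_delta3 hψ.rapid_delta3
      rw [← delta1_add hφ.smooth hψ.smooth] at h1
      rw [← delta2_add c hφ.smooth hψ.smooth] at h2
      rw [← delta3_add] at h3
      refine max_le (max_le (h1.trans ?_) (h2.trans ?_)) (h3.trans ?_)
      · exact add_le_add ((le_max_left _ _).trans (le_max_left _ _))
          ((le_max_left _ _).trans (le_max_left _ _))
      · exact add_le_add ((le_max_right _ _).trans (le_max_left _ _))
          ((le_max_right _ _).trans (le_max_left _ _))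
      · exact add_le_add (le_max_right _ _) (le_max_right _ _))
    (by
      rintro r ⟨⟨φ, hφ⟩, -⟩
      change max (max (norm1 (delta1 ((r : ℂ) • φ))) (norm1 (delta2 c ((r : ℂ) • φ))))
        (norm1 (delta3 ((r : ℂ) • φ))) = _
      rw [delta1_smul, delta2_smul, delta3_smul, norm1_smul, norm1_smul, norm1_smul,
        mul_max_of_nonneg _ _ (norm_nonneg r), mul_max_of_nonneg _ _ (norm_nonneg r)])

/-! ### The representation on `L²(ℝ × 𝕋 × ℤ)` and the order -/

/-- The product of Lebesgue, Haar and counting measure. -/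
def vol : Measure Pt := (volume : Measure ℝ).prod ((volume : Measure UnitAddCircle).prod .count)

/-- `L²(ℝ × 𝕋 × ℤ)`. -/
abbrev H : Type := Lp ℂ 2 vol

/-- The shift `(x, y, p) ↦ (x, y, p - q)`. -/
def shift (q : ℤ) : Pt → Pt := Prod.map id (Prod.map id fun p => p - q)

lemma shift_mp (q : ℤ) : MeasurePreserving (shift q) vol vol :=
  (MeasurePreserving.id _).prod
    ((MeasurePreserving.id _).prod (measurePreserving_sub_right Measure.count q))

/-- The coefficient `(x, y, p) ↦ Φ (x - ħ (q - 2 p) μ, y - ħ (q - 2 p) ν, q)`. -/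
def coef (hb mu nu : ℝ) (Φ : Pt → ℂ) (q : ℤ) : Pt → ℂ := fun z =>
  Φ (z.1 - hb * (q - 2 * z.2.2) * mu,
    z.2.1 - ((hb * (q - 2 * z.2.2) * nu : ℝ) : UnitAddCircle), q)

lemma IsSmooth.continuous_slice {Φ : Pt → ℂ} (h : IsSmooth Φ) (q : ℤ) :
    Continuous fun w : ℝ × UnitAddCircle => Φ (w.1, w.2, q) := by
  have hq : IsOpenQuotientMap (Prod.map id ((↑) : ℝ → UnitAddCircle) : ℝ × ℝ → _) :=
    IsOpenQuotientMap.id.prodMap QuotientAddGroup.isOpenQuotientMap_mk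
  rw [hq.isQuotientMap.continuous_iff]
  exact (h q).continuous

lemma coef_continuous (hb mu nu : ℝ) {Φ : Pt → ℂ} (h : IsSmooth Φ) (q : ℤ) :
    Continuous (coef hb mu nu Φ q) := by
  have hz : Continuous fun z : Pt => (z.2.2 : ℝ) :=
    (continuous_of_discreteTopology (f := fun n : ℤ => (n : ℝ))).comp (by fun_prop)
  have h2 : Continuous fun z : Pt =>
      ((hb * (q - 2 * z.2.2) * nu : ℝ) : UnitAddCircle) :=
    (AddCircle.continuous_mk' 1).comp (by fun_prop)
  exact (h.continuous_slice q).comp (f := fun z : Pt =>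
    (z.1 - hb * (q - 2 * z.2.2) * mu,
      z.2.1 - ((hb * (q - 2 * z.2.2) * nu : ℝ) : UnitAddCircle))) (by fun_prop)

lemma coef_memLp (hb mu nu : ℝ) {c : ℕ} (Φ : Sc c) (q : ℤ) :
    MemLp (coef hb mu nu Φ q) ∞ vol :=
  memLp_top_of_bound (coef_continuous hb mu nu (show MemS c Φ from Φ.2).smooth q).aestronglyMeasurable
    (supSlice Φ q) (.of_forall fun _ => (show MemS c Φ from Φ.2).rapid.le_supSlice _ _ _)

/-- The `q`-th term `ξ ↦ Φ(x - ħ(q - 2p)μ, y - ħ(q - 2p)ν, q) ξ(x, y, p - q)` of `π(Φ)`. -/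
def repTerm (hb mu nu : ℝ) {c : ℕ} (Φ : Sc c) (q : ℤ) : H →L[ℂ] H :=
  ((ContinuousLinearMap.mul ℂ ℂ).holderL vol ∞ 2 2 ((coef_memLp hb mu nu Φ q).toLp _)).comp
    (Lp.compMeasurePreservingₗᵢ ℂ (shift q) (shift_mp q)).toContinuousLinearMap

/-- The representation `π(Φ) ξ (x, y, p) = ∑_q Φ(x - ħ(q-2p)μ, y - ħ(q-2p)ν, q) ξ(x, y, p - q)`,
as an operator-norm convergent sum. -/
def rep (hb mu nu : ℝ) {c : ℕ} (Φ : Sc c) : H →L[ℂ] H := ∑' q : ℤ, repTerm hb mu nu Φ q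

lemma norm_repTerm_le (hb mu nu : ℝ) {c : ℕ} (Φ : Sc c) (q : ℤ) :
    ‖repTerm hb mu nu Φ q‖ ≤ supSlice Φ q := by
  refine ContinuousLinearMap.opNorm_le_bound _ (supSlice_nonneg _ _) fun ξ => ?_
  refine ((ContinuousLinearMap.mul ℂ ℂ).norm_holder_apply_apply_le _ _).trans ?_
  have h1 : ‖(Lp.compMeasurePreservingₗᵢ ℂ (shift q) (shift_mp q)) ξ‖ = ‖ξ‖ :=
    LinearIsometry.norm_map _ _
  have h2 : ‖(coef_memLp hb mu nu Φ q).toLp _‖ ≤ supSlice Φ q := by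
    rw [Lp.norm_toLp]
    refine ENNReal.toReal_le_of_le_ofReal (supSlice_nonneg _ _) ?_
    rw [eLpNorm_exponent_top]
    exact eLpNormEssSup_le_of_ae_bound
      (.of_forall fun _ => (show MemS c Φ from Φ.2).rapid.le_supSlice _ _ _)
  have h3 : ‖ContinuousLinearMap.mul ℂ ℂ‖ ≤ 1 := ContinuousLinearMap.opNorm_mul_le ℂ ℂ
  change _ * _ * ‖(Lp.compMeasurePreservingₗᵢ ℂ (shift q) (shift_mp q)) ξ‖ ≤ _
  rw [h1]
  refine mul_le_mul_of_nonneg_right ?_ (norm_nonneg _)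
  exact (mul_le_of_le_one_left (norm_nonneg _) h3).trans h2

lemma summable_repTerm (hb mu nu : ℝ) {c : ℕ} (Φ : Sc c) : Summable (repTerm hb mu nu Φ) :=
  Summable.of_norm_bounded (show MemS c Φ from Φ.2).rapid.summable (norm_repTerm_le hb mu nu Φ)

lemma repTerm_ae (hb mu nu : ℝ) {c : ℕ} (Φ : Sc c) (q : ℤ) (ξ : H) :
    repTerm hb mu nu Φ q ξ =ᵐ[vol] fun z => coef hb mu nu Φ q z * ξ (shift q z) := by
  have h1 := (ContinuousLinearMap.mul ℂ ℂ).coeFn_holder (r := 2)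
    ((coef_memLp hb mu nu Φ q).toLp _) (Lp.compMeasurePreserving (shift q) (shift_mp q) ξ)
  refine (show repTerm hb mu nu Φ q ξ =ᵐ[vol] _ from h1).trans ?_
  filter_upwards [(coef_memLp hb mu nu Φ q).coeFn_toLp,
    Lp.coeFn_compMeasurePreserving ξ (shift_mp q)] with z h2 h3
  rw [h2, h3]
  rfl

/-- The operator `rep` is given by the pointwise formula, with an absolutely convergent sum. -/
theorem rep_apply_ae (hb mu nu : ℝ) {c : ℕ} (Φ : Sc c) (ξ : H) :
    ∀ᵐ z ∂vol, HasSum (fun q : ℤ =>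
      (Φ : Pt → ℂ) (z.1 - hb * (q - 2 * z.2.2) * mu,
        z.2.1 - ((hb * (q - 2 * z.2.2) * nu : ℝ) : UnitAddCircle), q) *
      ξ (z.1, z.2.1, z.2.2 - q)) (rep hb mu nu Φ ξ z) := by
  have hR := (show MemS c Φ from Φ.2).rapid
  have hsum : HasSum (fun q => repTerm hb mu nu Φ q ξ) (rep hb mu nu Φ ξ) :=
    (summable_repTerm hb mu nu Φ).hasSum.mapL (ContinuousLinearMap.apply ℂ H ξ)
  have hIcc : Filter.Tendsto (fun N : ℕ => Finset.Icc (-(N : ℤ)) N) Filter.atTop Filter.atTop := by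
    refine Filter.tendsto_atTop_finset_of_monotone ?_ ?_
    · intro a b hab
      exact Finset.Icc_subset_Icc (by simpa using hab) (by simpa using hab)
    · intro x
      exact ⟨x.natAbs, by simp only [Finset.mem_Icc]; omega⟩
  have ht := (show Filter.Tendsto _ _ _ from hsum).comp hIcc
  obtain ⟨ns, hns, hae⟩ := (tendstoInMeasure_of_tendsto_Lp ht).exists_seq_tendsto_ae
  have hfin : ∀ᵐ z ∂vol, ∑' q : ℤ, ENNReal.ofReal (supSlice Φ q) * ‖ξ (shift q z)‖ₑ ^ 2 < ⊤ := by
    have hm : ∀ q : ℤ, AEMeasurable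
        (fun z => ENNReal.ofReal (supSlice Φ q) * ‖ξ (shift q z)‖ₑ ^ 2) vol := fun q =>
      (((Lp.aestronglyMeasurable ξ).comp_measurePreserving (shift_mp q)).enorm.pow_const
        2).const_mul _
    refine ae_lt_top' (AEMeasurable.tsum hm) ?_
    rw [lintegral_tsum hm]
    have hcomp : ∀ (q : ℤ) (g : Pt → ℝ≥0∞), AEMeasurable g vol →
        ∫⁻ z, g (shift q z) ∂vol = ∫⁻ z, g z ∂vol := fun q g hg => by
      conv_rhs => rw [← (shift_mp q).map_eq]
      rw [lintegral_map' (by rw [(shift_mp q).map_eq]; exact hg)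
        (shift_mp q).measurable.aemeasurable]
    have hi : ∀ q : ℤ, ∫⁻ z, ENNReal.ofReal (supSlice Φ q) * ‖ξ (shift q z)‖ₑ ^ 2 ∂vol =
        ENNReal.ofReal (supSlice Φ q) * ∫⁻ z, ‖ξ z‖ₑ ^ 2 ∂vol := fun q => by
      rw [lintegral_const_mul' _ _ ENNReal.ofReal_ne_top]
      congr 1
      exact hcomp q _ ((Lp.aestronglyMeasurable ξ).enorm.pow_const 2)
    simp_rw [hi]
    rw [ENNReal.tsum_mul_right]
    refine ENNReal.mul_ne_top hR.summable.tsum_ofReal_ne_top ?_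
    have := (lintegral_rpow_enorm_lt_top_of_eLpNorm_lt_top (p := 2) (by simp) (by simp)
      (Lp.eLpNorm_lt_top ξ)).ne
    simpa using this
  filter_upwards [hae, hfin, ae_all_iff.mpr fun q => repTerm_ae hb mu nu Φ q ξ,
    ae_all_iff.mpr fun N : ℕ => Lp.coeFn_finsetSum (Finset.Icc (-(N : ℤ)) N)
      (fun q => repTerm hb mu nu Φ q ξ)] with z hz hzf hzt hzs
  have hS : Summable fun q : ℤ => coef hb mu nu Φ q z * ξ (shift q z) := by
    have hs2 : Summable fun q : ℤ => supSlice Φ q * ‖ξ (shift q z)‖ ^ 2 := by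
      have := ENNReal.summable_toReal hzf.ne
      refine this.congr fun q => ?_
      rw [ENNReal.toReal_mul, ENNReal.toReal_ofReal (supSlice_nonneg _ _), ENNReal.toReal_pow,
        toReal_enorm]
    refine Summable.of_norm_bounded (hR.summable.add hs2) fun q => ?_
    rw [norm_mul]
    have h1 : ‖coef hb mu nu Φ q z‖ ≤ supSlice Φ q := hR.le_supSlice _ _ _
    have h0 := supSlice_nonneg (Φ : Pt → ℂ) q
    have hn := norm_nonneg (ξ (shift q z))
    calc _ ≤ supSlice Φ q * ‖ξ (shift q z)‖ := by gcongr
      _ ≤ supSlice Φ q * (1 + ‖ξ (shift q z)‖ ^ 2) := by gcongr; nlinarith [sq_nonneg (‖ξ (shift q z)‖ - 1)]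
      _ = _ := by ring
  have h2 := ((show Filter.Tendsto _ _ _ from hS.hasSum).comp hIcc).comp hns.tendsto_atTop
  have h3 : rep hb mu nu Φ ξ z = ∑' q : ℤ, coef hb mu nu Φ q z * ξ (shift q z) := by
    refine tendsto_nhds_unique hz (h2.congr fun i => ?_)
    simp only [Function.comp]
    rw [hzs]
    simp [hzt]
  rw [h3]
  exact hS.hasSum

/-- The order of the self-adjoint part, inherited from the C*-algebra generated by `π(S^c)`:
`φ ≤ ψ` when `π(ψ) - π(φ)` is a positive operator. -/
def le (c : ℕ) (hb mu nu : ℝ) (φ ψ : saPart c) : Prop :=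
  (rep hb mu nu (ψ : Sc c) - rep hb mu nu (φ : Sc c)).IsPositive

end QHM

end

/-! ### A total boundedness criterion for Lip norms -/

section Criterion

variable {A : Type*} [AddCommGroup A] [Module ℝ A] {le : A → A → Prop} {e : A}

/-! The seminorm `L` is compared with the single norm `norm1`, never with the operator norm. Since
`‖π(Φ)‖ ≤ norm1 Φ`, the order unit norm is at most `norm1`, so every state satisfies `|f a| ≤ norm1
a` (`QHM.abs_state_le`). By `IsLipNorm.of_finite_net` it then suffices that `L` vanishes exactly on
the multiples of the unit and that `{L ≤ 1}` is totally bounded for `norm1` modulo these multiples.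

Total boundedness is an Arzelà–Ascoli argument. The bound on `δ₃` makes the slices with large `|p|`
uniformly negligible (`QHM.norm1_le_of_slices`). Quasi-periodicity reduces each remaining slice to
the unit square, where the three bounds together control the gradient (`QHM.norm_fderiv_lift_le`).
Hence finitely many values at grid points determine an element of the ball up to `ε`, once its value
at the base point of the slice `p = 0` is normalised to zero. The same estimates give the kernel of
`L`.

The order unit axioms are read off from quadratic forms: `π(φ)` is symmetric for self-adjoint `φ`
(`QHM.isSymmetric_rep`), and antisymmetry of the order is the faithfulness of `π`
(`QHM.eq_zero_of_rep_eq_zero`). -/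

theorem OrderUnitState.ext_toFun {f g : OrderUnitState le e} (h : f.toFun = g.toFun) : f = g := by
  cases f; cases g; cases h; rfl

/-- If states are dominated by `N` and `{L ≤ 1}` is totally bounded for `N` modulo `ℝ e`, then the
difference of two states on `{L ≤ 1}` is controlled by finitely many values. -/
theorem OrderUnitState.exists_finite_control {L : Seminorm ℝ A} {N : A → ℝ}
    (hN : ∀ (f : OrderUnitState le e) (a : A), |f.toFun a| ≤ N a)
    (hnet : ∀ ε : ℝ, 0 < ε → ∃ F : Set A, F.Finite ∧
      ∀ a, L a ≤ 1 → ∃ b ∈ F, ∃ r : ℝ, N (a - b - r • e) ≤ ε) {ε : ℝ} (hε : 0 < ε) :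
    ∃ F : Set A, F.Finite ∧ ∀ (f g : OrderUnitState le e) (δ : ℝ),
      (∀ b ∈ F, |f.toFun b - g.toFun b| ≤ δ) →
        ∀ a, L a ≤ 1 → |f.toFun a - g.toFun a| ≤ δ + ε := by
  obtain ⟨F, hF, h⟩ := hnet (ε / 2) (by positivity)
  refine ⟨F, hF, fun f g δ hδ a ha => ?_⟩
  obtain ⟨b, hb, r, hr⟩ := h a ha
  have h1 := (hN f _).trans hr
  have h2 := (hN g _).trans hr
  have h3 := hδ b hb
  simp only [map_sub, map_smul, f.map_unit, g.map_unit, smul_eq_mul, mul_one] at h1 h2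
  rw [abs_le] at *
  -- The terms in `r` cancel because both states take the value 1 at `e`; each state contributes an
  -- error of at most `ε / 2`.
  constructor <;> linarith

/-- A seminorm vanishing exactly on `ℝ e` whose unit ball is totally bounded modulo `ℝ e` is a
Lip norm. -/
theorem IsLipNorm.of_finite_net {L : Seminorm ℝ A} {N : A → ℝ}
    (hN : ∀ (f : OrderUnitState le e) (a : A), |f.toFun a| ≤ N a)
    (h0 : ∀ a, L a = 0 ↔ ∃ r : ℝ, a = r • e)
    (hnet : ∀ ε : ℝ, 0 < ε → ∃ F : Set A, F.Finite ∧
      ∀ a, L a ≤ 1 → ∃ b ∈ F, ∃ r : ℝ, N (a - b - r • e) ≤ ε) :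
    IsLipNorm le e L := by
  refine ⟨h0, ?_⟩
  let S : OrderUnitState le e → OrderUnitState le e → Set ℝ := fun f g =>
    {t : ℝ | ∃ a, L a ≤ 1 ∧ t = |f.toFun a - g.toFun a|}
  have hlub : ∀ f g, IsLUB (S f g) (sSup (S f g)) := fun f g => by
    refine isLUB_csSup ⟨_, 0, by simp, rfl⟩ ?_
    obtain ⟨F, hF, h⟩ := OrderUnitState.exists_finite_control hN hnet one_pos
    obtain ⟨C, hC⟩ := (hF.image fun b => |f.toFun b - g.toFun b|).bddAbove
    refine ⟨C + 1, ?_⟩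
    rintro _ ⟨a, ha, rfl⟩
    exact h f g C (fun b hb => hC ⟨b, hb, rfl⟩) a ha
  -- Homogeneity: rescale `a` into the unit ball. If `L a = 0`, then `a` is a multiple of `e` and
  -- all states agree on it.
  have hle : ∀ f g a, |f.toFun a - g.toFun a| ≤ L a * sSup (S f g) := fun f g a => by
    rcases (apply_nonneg L a).eq_or_lt with h | h
    · obtain ⟨r, rfl⟩ := (h0 a).1 h.symm
      simp [f.map_unit, g.map_unit, ← h]
    · have := (hlub f g).1 ⟨(L a)⁻¹ • a, by
        rw [map_smul_eq_mul, Real.norm_of_nonneg (inv_nonneg.2 h.le), inv_mul_cancel₀ h.ne'], rfl⟩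
      rwa [map_smul, map_smul, ← smul_sub, smul_eq_mul, abs_mul, abs_of_pos (inv_pos.2 h),
        inv_mul_le_iff₀ h] at this
  have hsymm : ∀ f g, S f g = S g f := fun f g => by
    ext t; simp only [S, Set.mem_ofPred_eq, abs_sub_comm]
  have hnonneg : ∀ f g, 0 ≤ sSup (S f g) := fun f g =>
    (hlub f g).1 ⟨0, by simp, by simp⟩
  let d : MetricSpace (OrderUnitState le e) :=
    { dist := fun f g => sSup (S f g)
      dist_self := fun f => by
        refine le_antisymm ((hlub f f).2 ?_) (hnonneg f f)
        rintro _ ⟨a, -, rfl⟩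
        simp
      dist_comm := fun f g => by rw [hsymm]
      dist_triangle := fun f g h => by
        refine (hlub f h).2 ?_
        rintro _ ⟨a, ha, rfl⟩
        exact (abs_sub_le _ (g.toFun a) _).trans
          (add_le_add ((hlub f g).1 ⟨a, ha, rfl⟩) ((hlub g h).1 ⟨a, ha, rfl⟩))
      eq_of_dist_eq_zero := fun {f g} h => by
        refine OrderUnitState.ext_toFun (LinearMap.ext fun a => ?_)
        have := hle f g a
        rw [show sSup (S f g) = 0 from h, mul_zero] at this
        exact sub_eq_zero.1 (abs_nonpos_iff.1 this) }
  refine ⟨d, hlub, TopologicalSpace.ext_nhds fun f => ?_⟩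
  rw [nhds_induced, nhds_pi]
  refine le_antisymm ?_ ?_
  -- Metric convergence implies pointwise convergence, by `hle`; `L a + 1` replaces `L a` to avoid
  -- dividing by zero.
  · rw [← Filter.tendsto_iff_comap, Filter.tendsto_pi]
    intro a
    rw [Metric.tendsto_nhds]
    intro ε hε
    have hL : 0 < L a + 1 := by have := apply_nonneg L a; linarith
    filter_upwards [Metric.ball_mem_nhds f (div_pos hε hL)] with g hg
    have hg : sSup (S g f) < ε / (L a + 1) := hg
    rw [Real.dist_eq]
    calc |g.toFun a - f.toFun a| ≤ L a * sSup (S g f) := hle g f a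
      _ ≤ (L a + 1) * sSup (S g f) := by gcongr; exacts [hnonneg _ _, by linarith]
      _ < ε := by rwa [lt_div_iff₀' hL] at hg
  -- Conversely, closeness to `f` on the finite control set, a w*-neighbourhood, forces closeness in
  -- the metric.
  · rw [Metric.nhds_basis_ball.ge_iff]
    intro ε hε
    obtain ⟨F, hF, h⟩ := OrderUnitState.exists_finite_control hN hnet (show 0 < ε / 3 by positivity)
    have hmem : {v : A → ℝ | ∀ b ∈ F, |v b - f.toFun b| ≤ ε / 3} ∈
        Filter.pi fun a => nhds (f.toFun a) := by
      have : {v : A → ℝ | ∀ b ∈ F, |v b - f.toFun b| ≤ ε / 3} =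
          F.pi fun b => Metric.closedBall (f.toFun b) (ε / 3) := by
        ext v; simp [Set.mem_pi, Real.dist_eq]
      rw [this]
      exact Filter.pi_mem_pi hF fun b _ => Metric.closedBall_mem_nhds _ (by positivity)
    refine ⟨_, hmem, fun g hg => ?_⟩
    have : sSup (S g f) ≤ ε / 3 + ε / 3 := by
      refine (hlub g f).2 ?_
      rintro _ ⟨a, ha, rfl⟩
      exact h g f _ hg a ha
    change sSup (S g f) < ε
    linarith

end Criterion

namespace QHM

/-! ### The representation -/

section Representation

variable {c : ℕ} (hb mu nu : ℝ)

theorem rep_add (Φ Ψ : Sc c) : rep hb mu nu (Φ + Ψ) = rep hb mu nu Φ + rep hb mu nu Ψ := by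
  ext1 ξ
  refine Lp.ext ?_
  filter_upwards [rep_apply_ae hb mu nu Φ ξ, rep_apply_ae hb mu nu Ψ ξ,
    rep_apply_ae hb mu nu (Φ + Ψ) ξ, Lp.coeFn_add (rep hb mu nu Φ ξ) (rep hb mu nu Ψ ξ)]
    with z h1 h2 h3 h4
  rw [add_apply, h4]
  refine h3.unique ((h1.add h2).congr_fun fun q => ?_)
  simp [add_mul]

theorem rep_smul (a : ℂ) (Φ : Sc c) : rep hb mu nu (a • Φ) = a • rep hb mu nu Φ := by
  ext1 ξ
  refine Lp.ext ?_
  filter_upwards [rep_apply_ae hb mu nu Φ ξ, rep_apply_ae hb mu nu (a • Φ) ξ,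
    Lp.coeFn_smul a (rep hb mu nu Φ ξ)] with z h1 h2 h3
  rw [smul_apply, h3]
  refine h2.unique ((h1.mul_left a).congr_fun fun q => ?_)
  simp [mul_assoc]

theorem norm_rep_le (Φ : Sc c) : ‖rep hb mu nu Φ‖ ≤ norm1 Φ :=
  tsum_of_norm_bounded (show MemS c Φ from Φ.2).rapid.summable.hasSum (norm_repTerm_le hb mu nu Φ)

theorem rep_unit : rep hb mu nu (unit c : Sc c) = 1 := by
  ext1 ξ
  refine Lp.ext ?_
  filter_upwards [rep_apply_ae hb mu nu (unit c : Sc c) ξ] with z h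
  refine h.unique ?_
  have := hasSum_ite_eq (0 : ℤ) (ξ z)
  refine this.congr_fun fun q => ?_
  by_cases hq : q = 0
  · subst hq; simp [unit, unitFun]
  · simp [unit, unitFun, hq]

/-- Substitute `p ↦ p + q`. The factor `q - 2p` becomes `-q - 2p`, exactly the one in the term of
index `-q`, and `φ* = φ` converts the conjugate of the slice at `q` into the slice at `-q`. -/
theorem inner_repTerm {φ : saPart c} (q : ℤ) (ξ η : H) :
    inner ℂ (repTerm hb mu nu (φ : Sc c) q ξ) η = inner ℂ ξ (repTerm hb mu nu (φ : Sc c) (-q) η) := by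
  have hφ : invol (φ : Sc c) = (φ : Sc c) := φ.2
  rw [L2.inner_def, L2.inner_def]
  have hemb : MeasurableEmbedding (shift (-q)) := by
    exact MeasurableEmbedding.id.prodMap
      (MeasurableEmbedding.id.prodMap (MeasurableEquiv.subRight (-q)).measurableEmbedding)
  rw [← (shift_mp (-q)).integral_comp hemb]
  refine integral_congr_ae ?_
  filter_upwards [(shift_mp (-q)).quasiMeasurePreserving.ae (repTerm_ae hb mu nu (φ : Sc c) q ξ),
    repTerm_ae hb mu nu (φ : Sc c) (-q) η] with z h1 h2
  rw [h1, h2]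
  have hs : shift q (shift (-q) z) = z := by
    obtain ⟨x, y, p⟩ := z
    simp [shift]
  have hc : conj (coef hb mu nu (φ : Sc c) q (shift (-q) z)) =
      coef hb mu nu (φ : Sc c) (-q) z := by
    have := congrFun hφ (z.1 - hb * ((-q : ℤ) - 2 * z.2.2) * mu,
      z.2.1 - ((hb * ((-q : ℤ) - 2 * z.2.2) * nu : ℝ) : UnitAddCircle), -q)
    simp only [invol, neg_neg] at this
    simp only [coef]
    rw [← this]
    have e : (q : ℝ) - 2 * ((shift (-q) z).2.2 : ℝ) = ((-q : ℤ) : ℝ) - 2 * z.2.2 := by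
      simp [shift]; ring
    rw [e]
    rfl
  rw [hs, ← hc]
  simp only [RCLike.inner_apply, map_mul]
  ring

theorem isSymmetric_rep (φ : saPart c) : (rep hb mu nu (φ : Sc c)).IsSymmetric := by
  intro ξ η
  have h1 : ∀ ζ : H, HasSum (fun q => repTerm hb mu nu (φ : Sc c) q ζ)
      (rep hb mu nu (φ : Sc c) ζ) := fun ζ =>
    (summable_repTerm hb mu nu (φ : Sc c)).hasSum.mapL (ContinuousLinearMap.apply ℂ H ζ)
  have h2 := (h1 η).mapL (innerSL ℂ ξ)
  have h3 := ((h1 ξ).mapL (innerSL ℂ η)).map (starRingEnd ℂ) Complex.continuous_conj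
  rw [← (Equiv.neg ℤ).hasSum_iff] at h2
  have := h3.unique (h2.congr_fun fun q => ?_)
  · simpa using this
  · simp [inner_repTerm]

/-! ### The order through quadratic forms, and faithfulness -/

theorem le_iff (φ ψ : saPart c) : le c hb mu nu φ ψ ↔ ∀ ξ : H,
    (inner ℂ (rep hb mu nu (φ : Sc c) ξ) ξ).re ≤ (inner ℂ (rep hb mu nu (ψ : Sc c) ξ) ξ).re := by
  have hs : (rep hb mu nu (ψ : Sc c) - rep hb mu nu (φ : Sc c)).IsSymmetric :=
    (isSymmetric_rep hb mu nu ψ).sub (isSymmetric_rep hb mu nu φ)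
  rw [le, ContinuousLinearMap.isPositive_def, and_iff_right hs]
  refine forall_congr' fun ξ => ?_
  simp [ContinuousLinearMap.reApplyInnerSelf_apply, inner_sub_left]

/-- The quadratic form of `π(φ)` at a vector. -/
noncomputable def quad (φ : saPart c) (ξ : H) : ℝ := (inner ℂ (rep hb mu nu (φ : Sc c) ξ) ξ).re

theorem quad_add (φ ψ : saPart c) (ξ : H) :
    quad hb mu nu (φ + ψ) ξ = quad hb mu nu φ ξ + quad hb mu nu ψ ξ := by
  simp [quad, rep_add, inner_add_left]

theorem quad_smul (r : ℝ) (φ : saPart c) (ξ : H) :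
    quad hb mu nu (r • φ) ξ = r * quad hb mu nu φ ξ := by
  have : ((r • φ : saPart c) : Sc c) = (r : ℂ) • (φ : Sc c) := rfl
  rw [quad, this, rep_smul, smul_apply, inner_smul_left]
  simp [quad]

theorem quad_unit (ξ : H) : quad hb mu nu (unit c) ξ = ‖ξ‖ ^ 2 := by
  rw [quad, rep_unit, one_apply_eq_self]
  exact inner_self_eq_norm_sq (𝕜 := ℂ) ξ

theorem abs_quad_le (φ : saPart c) (ξ : H) :
    |quad hb mu nu φ ξ| ≤ norm1 (φ : Sc c) * ‖ξ‖ ^ 2 := by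
  refine (Complex.abs_re_le_norm _).trans ((norm_inner_le_norm _ _).trans ?_)
  rw [sq, ← mul_assoc]
  gcongr
  exact (ContinuousLinearMap.le_opNorm _ _).trans (by gcongr; exact norm_rep_le hb mu nu _)

instance isOpenPosMeasure_vol : vol.IsOpenPosMeasure := by
  unfold vol
  infer_instance

/-- Apply `π(Φ)` to the indicator of a set in the fibre over `0`: at a point of the fibre over `p`
only the term `q = p` survives, so the coefficient of index `p` vanishes almost everywhere on an
open set. By continuity it cannot be nonzero anywhere there. -/
theorem eq_zero_of_rep_eq_zero (Φ : Sc c) (h : rep hb mu nu Φ = 0) : (Φ : Pt → ℂ) = 0 := by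
  have hsm : IsSmooth Φ := (show MemS c Φ from Φ.2).smooth
  by_contra hne
  obtain ⟨⟨x, y, p⟩, hx⟩ := Function.ne_iff.1 hne
  -- Chosen so that the twisted argument of the coefficient at `z₀` is exactly `(x, y)`.
  let z₀ : Pt := (x + hb * (p - 2 * p) * mu, y + ((hb * (p - 2 * p) * nu : ℝ) : UnitAddCircle), p)
  let s : Set Pt := Metric.ball z₀.1 1 ×ˢ Set.univ ×ˢ {0}
  have hs : MeasurableSet s := measurableSet_ball.prod (MeasurableSet.univ.prod (by measurability))
  have hsv : vol s ≠ ⊤ := by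
    simp only [s, vol, Measure.prod_prod]
    simp
  let U : Set Pt := {z | coef hb mu nu Φ p z ≠ 0} ∩ (Metric.ball z₀.1 1 ×ˢ Set.univ ×ˢ {p})
  have hU : IsOpen U := ((coef_continuous hb mu nu hsm p).isOpen_preimage _ isOpen_ne).inter
    (Metric.isOpen_ball.prod (isOpen_univ.prod (isOpen_discrete _)))
  have hz : z₀ ∈ U := by
    refine ⟨?_, by simp [z₀]⟩
    simpa [coef, z₀] using hx
  refine (hU.measure_pos vol ⟨z₀, hz⟩).ne' ?_
  have hξ := (indicatorConstLp_coeFn (p := 2) (hs := hs) (hμs := hsv) (c := (1 : ℂ)))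
  rw [measure_eq_zero_iff_ae_notMem]
  filter_upwards [rep_apply_ae hb mu nu Φ (indicatorConstLp 2 hs hsv 1),
    ae_all_iff.2 fun q => (shift_mp q).quasiMeasurePreserving.ae hξ,
    Lp.coeFn_zero ℂ 2 vol] with z h1 h2 h3
  rintro ⟨hz1, hz2⟩
  obtain ⟨hz2, -, hz3⟩ := hz2
  have hz3 : z.2.2 = p := hz3
  rw [h, zero_apply, h3] at h1
  refine hz1 (HasSum.unique ?_ h1)
  refine (hasSum_ite_eq p (coef hb mu nu Φ p z)).congr_fun fun q => ?_
  have h4 : ((indicatorConstLp 2 hs hsv 1 : H)) (z.1, z.2.1, z.2.2 - q) =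
      s.indicator (fun _ => 1) (z.1, z.2.1, z.2.2 - q) := h2 q
  rw [h4]
  by_cases hq : q = p
  · subst hq
    have : (z.1, z.2.1, z.2.2 - q) ∈ s := ⟨hz2, trivial, by simp [hz3]⟩
    simp [this, coef]
  · have : (z.1, z.2.1, z.2.2 - q) ∉ s := fun hh => hq <| by
      have : z.2.2 - q = 0 := hh.2.2
      omega
    simp [this, hq]

/-! ### Order unit axioms and domination of states -/

theorem norm1_real_smul (r : ℝ) (φ : saPart c) :
    norm1 ((r • φ : saPart c) : Sc c) = |r| * norm1 (φ : Sc c) := norm1_smul r _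

theorem neg_norm1_smul_unit_le (φ : saPart c) {r : ℝ} (hr : norm1 (φ : Sc c) ≤ r) :
    le c hb mu nu ((-r) • unit c) φ := by
  refine (le_iff hb mu nu _ _).2 fun ξ => ?_
  change quad hb mu nu _ ξ ≤ quad hb mu nu _ ξ
  rw [quad_smul, quad_unit]
  have := (abs_le.1 (abs_quad_le hb mu nu φ ξ)).1
  nlinarith [sq_nonneg ‖ξ‖]

theorem le_norm1_smul_unit (φ : saPart c) {r : ℝ} (hr : norm1 (φ : Sc c) ≤ r) :
    le c hb mu nu φ (r • unit c) := by
  refine (le_iff hb mu nu _ _).2 fun ξ => ?_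
  change quad hb mu nu _ ξ ≤ quad hb mu nu _ ξ
  rw [quad_smul, quad_unit]
  have := (abs_le.1 (abs_quad_le hb mu nu φ ξ)).2
  nlinarith [sq_nonneg ‖ξ‖]

theorem isOrderUnitSpace : IsOrderUnitSpace (le c hb mu nu) (unit c) where
  refl a := (le_iff hb mu nu _ _).2 fun _ => le_rfl
  trans a b d h h' := (le_iff hb mu nu _ _).2 fun ξ =>
    ((le_iff hb mu nu _ _).1 h ξ).trans ((le_iff hb mu nu _ _).1 h' ξ)
  antisymm a b h h' := by
    let d : saPart c := a + (-1 : ℝ) • b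
    have h0 : rep hb mu nu (d : Sc c) = 0 := by
      -- A symmetric operator whose quadratic form vanishes is zero; faithfulness then gives `a =
      -- b`.
      refine ContinuousLinearMap.coe_injective
        ((isSymmetric_rep hb mu nu d).inner_map_self_eq_zero.1 fun ξ => ?_)
      have h1 : quad hb mu nu d ξ = 0 := by
        have h2 : quad hb mu nu a ξ ≤ quad hb mu nu b ξ := (le_iff hb mu nu _ _).1 h ξ
        have h3 : quad hb mu nu b ξ ≤ quad hb mu nu a ξ := (le_iff hb mu nu _ _).1 h' ξ
        rw [quad_add, quad_smul]
        linarith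
      have h2 := (isSymmetric_rep hb mu nu d).coe_re_inner_apply_self ξ
      rw [← h2]
      exact congrArg _ h1
    refine Subtype.ext (Subtype.ext (funext fun z => ?_))
    have h4 : (a : Sc c).1 z + ((-1 : ℝ) : ℂ) * (b : Sc c).1 z = 0 :=
      congrFun (eq_zero_of_rep_eq_zero hb mu nu _ h0) z
    push_cast at h4
    linear_combination h4
  add_right a b d h := (le_iff hb mu nu _ _).2 fun ξ => by
    change quad hb mu nu _ ξ ≤ quad hb mu nu _ ξ
    rw [quad_add, quad_add]
    exact add_le_add_left ((le_iff hb mu nu _ _).1 h ξ) _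
  smul_nonneg r a b hr h := (le_iff hb mu nu _ _).2 fun ξ => by
    change quad hb mu nu _ ξ ≤ quad hb mu nu _ ξ
    rw [quad_smul, quad_smul]
    exact mul_le_mul_of_nonneg_left ((le_iff hb mu nu _ _).1 h ξ) hr
  order_unit a := ⟨_, le_norm1_smul_unit hb mu nu a le_rfl⟩
  archimedean a h := (le_iff hb mu nu _ _).2 fun ξ => by
    change quad hb mu nu _ ξ ≤ quad hb mu nu _ ξ
    rw [← zero_smul ℝ (unit c), quad_smul, zero_mul]
    refine le_of_forall_pos_le_add fun ε hε => ?_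
    have h1 := (le_iff hb mu nu _ _).1 (h (ε / (‖ξ‖ ^ 2 + 1)) (by positivity)) ξ
    change quad hb mu nu _ ξ ≤ quad hb mu nu _ ξ at h1
    rw [quad_smul, quad_unit] at h1
    refine h1.trans ?_
    rw [zero_add, div_mul_eq_mul_div, div_le_iff₀ (by positivity)]
    nlinarith

theorem orderUnitNorm_le (φ : saPart c) :
    orderUnitNorm (le c hb mu nu) (unit c) φ ≤ norm1 (φ : Sc c) := by
  by_cases h : BddBelow {r : ℝ | le c hb mu nu ((-r) • unit c) φ ∧ le c hb mu nu φ (r • unit c)}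
  · exact csInf_le h
      ⟨neg_norm1_smul_unit_le hb mu nu φ le_rfl, le_norm1_smul_unit hb mu nu φ le_rfl⟩
  -- Here the infimum takes the default value 0, so the bound still holds.
  · rw [orderUnitNorm, Real.sInf_of_not_bddBelow h]
    exact norm1_nonneg _

/-- For every `s > norm1 φ` the element `s⁻¹ φ` has order unit norm at most 1, so the dual norm
condition applies; the strict inequality keeps `s` positive even if `norm1 φ = 0`. -/
theorem abs_state_le (f : OrderUnitState (le c hb mu nu) (unit c)) (φ : saPart c) :
    |f.toFun φ| ≤ norm1 (φ : Sc c) := by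
  refine le_of_forall_gt_imp_ge_of_dense fun s hs => ?_
  have hs0 : 0 < s := (norm1_nonneg _).trans_lt hs
  have h1 : orderUnitNorm (le c hb mu nu) (unit c) (s⁻¹ • φ) ≤ 1 := by
    refine (orderUnitNorm_le hb mu nu _).trans ?_
    rw [norm1_real_smul, abs_of_pos (inv_pos.2 hs0), inv_mul_le_iff₀ hs0, mul_one]
    exact hs.le
  have h2 := f.dual_norm.1 ⟨_, h1, rfl⟩
  rwa [map_smul, smul_eq_mul, abs_mul, abs_of_pos (inv_pos.2 hs0), inv_mul_le_iff₀ hs0,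
    mul_one] at h2

end Representation

end QHM

namespace QHM

/-! ### Total boundedness of the unit ball of `L` -/

section Compactness

variable {c : ℕ}

theorem Rapid.supSlice_le_norm1 {Φ : Pt → ℂ} (h : Rapid Φ) (p : ℤ) : supSlice Φ p ≤ norm1 Φ :=
  h.summable.le_tsum p fun q _ => supSlice_nonneg Φ q

theorem Rapid.norm_le_norm1 {Φ : Pt → ℂ} (h : Rapid Φ) (z : Pt) : ‖Φ z‖ ≤ norm1 Φ :=
  (h.le_supSlice z.1 z.2.1 z.2.2).trans (h.supSlice_le_norm1 _)

theorem memS (φ : saPart c) : MemS c (φ : Sc c) := (φ : Sc c).2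

theorem norm1_delta1_le (φ : saPart c) : norm1 (delta1 (φ : Sc c)) ≤ lipL c φ :=
  (le_max_left _ _).trans (le_max_left _ _)

theorem norm1_delta2_le (φ : saPart c) : norm1 (delta2 c (φ : Sc c)) ≤ lipL c φ :=
  (le_max_right _ _).trans (le_max_left _ _)

theorem norm1_delta3_le (φ : saPart c) : norm1 (delta3 (φ : Sc c)) ≤ lipL c φ :=
  le_max_right _ _

theorem norm_delta3 (Φ : Pt → ℂ) (z : Pt) :
    ‖delta3 Φ z‖ = 2 * Real.pi * |(z.2.2 : ℝ)| * ‖Φ z‖ := by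
  simp [delta3, abs_of_pos Real.pi_pos]

/-! ### Reduction to the unit square and gradient bounds -/

/-- The unit square, on which the slices of elements of `S^c` are determined. -/
def square : Set (ℝ × ℝ) := Set.Icc 0 1 ×ˢ Set.Icc 0 1

theorem zero_mem_square : (0 : ℝ × ℝ) ∈ square := by
  constructor <;> simp

/-- Integer translations in `x` only multiply by a phase of modulus 1, and `y` is already a class
modulo 1. -/
theorem MemS.exists_square {Φ : Pt → ℂ} (h : MemS c Φ) (x : ℝ) (y : UnitAddCircle) (p : ℤ) :
    ∃ z ∈ square, ‖Φ (x, y, p)‖ = ‖lift Φ p z‖ := by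
  obtain ⟨t, rfl⟩ := QuotientAddGroup.mk_surjective y
  refine ⟨(Int.fract x, Int.fract t), ⟨⟨Int.fract_nonneg x, (Int.fract_lt_one x).le⟩,
    ⟨Int.fract_nonneg t, (Int.fract_lt_one t).le⟩⟩, ?_⟩
  have h1 := h.quasi ⌊x⌋ (Int.fract x) (t : UnitAddCircle) p
  rw [Int.fract_add_floor] at h1
  have h2 : ((Int.fract t : ℝ) : UnitAddCircle) = (t : UnitAddCircle) := by
    conv_rhs => rw [← Int.fract_add_floor t]
    rw [AddCircle.coe_add, left_eq_add]
    exact (AddCircle.coe_eq_zero_iff (1 : ℝ)).2 ⟨⌊t⌋, by simp⟩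
  change ‖Φ (x, (t : UnitAddCircle), p)‖ = ‖Φ (Int.fract x, ((Int.fract t : ℝ) : UnitAddCircle), p)‖
  rw [h1, h2, norm_mul, norm_fourier, one_mul]

theorem norm_dx_le (φ : saPart c) (z : Pt) : ‖dx (φ : Sc c) z‖ ≤ lipL c φ := by
  have := ((memS φ).rapid_delta1.norm_le_norm1 z).trans (norm1_delta1_le φ)
  rwa [delta1, norm_neg] at this

/-- From `∂φ/∂y = c x δ₃φ - δ₂φ`; the unbounded factor `x` is why the estimate is confined to `0 ≤ x
≤ 1`. -/
theorem norm_dy_le (φ : saPart c) {z : Pt} (hz : z.1 ∈ Set.Icc (0 : ℝ) 1) :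
    ‖dy (φ : Sc c) z‖ ≤ (1 + c) * lipL c φ := by
  have h2 := ((memS φ).rapid_delta2.norm_le_norm1 z).trans (norm1_delta2_le φ)
  have h3 := ((memS φ).rapid_delta3.norm_le_norm1 z).trans (norm1_delta3_le φ)
  have e : dy (φ : Sc c) z = c * z.1 * delta3 (φ : Sc c) z - delta2 c (φ : Sc c) z := by
    simp only [delta2, delta3]; ring
  have hx : ‖(z.1 : ℂ)‖ ≤ 1 := by
    rw [Complex.norm_real, Real.norm_of_nonneg hz.1]; exact hz.2
  calc _ ≤ c * ‖(z.1 : ℂ)‖ * ‖delta3 (φ : Sc c) z‖ + ‖delta2 c (φ : Sc c) z‖ := by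
        rw [e]; refine (norm_sub_le _ _).trans ?_; simp
    _ ≤ c * 1 * lipL c φ + lipL c φ := by gcongr
    _ = _ := by ring

theorem norm_fderiv_lift_le (φ : saPart c) (p : ℤ) {z : ℝ × ℝ} (hz : z ∈ square) :
    ‖fderiv ℝ (lift (φ : Sc c) p) z‖ ≤ (2 + c) * lipL c φ := by
  have h0 : 0 ≤ lipL c φ := apply_nonneg _ _
  refine ContinuousLinearMap.opNorm_le_bound _ (by positivity) fun v => ?_
  have e : v = v.1 • ((1, 0) : ℝ × ℝ) + v.2 • ((0, 1) : ℝ × ℝ) := by ext <;> simp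
  conv_lhs => rw [e]
  rw [map_add, map_smul, map_smul, ← dx_lift (memS φ).smooth, ← dy_lift (memS φ).smooth]
  refine (norm_add_le _ _).trans ?_
  rw [norm_smul, norm_smul]
  calc _ ≤ ‖v‖ * lipL c φ + ‖v‖ * ((1 + c) * lipL c φ) := by
        gcongr
        exacts [norm_fst_le v, norm_dx_le φ _, norm_snd_le v, norm_dy_le φ hz.1]
    _ = _ := by ring

theorem norm_lift_sub_le (φ : saPart c) (p : ℤ) {z w : ℝ × ℝ} (hz : z ∈ square)
    (hw : w ∈ square) :
    ‖lift (φ : Sc c) p z - lift (φ : Sc c) p w‖ ≤ (2 + c) * lipL c φ * ‖z - w‖ :=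
  ((convex_Icc 0 1).prod (convex_Icc 0 1)).norm_image_sub_le_of_norm_fderiv_le
    (fun _ _ => ((memS φ).smooth p).differentiable (by simp) _)
    (fun _ hx => norm_fderiv_lift_le φ p hx) hw hz

theorem norm_sub_le_of_mem_square {z : ℝ × ℝ} (hz : z ∈ square) : ‖z - 0‖ ≤ 1 := by
  rw [sub_zero, Prod.norm_def, Real.norm_of_nonneg hz.1.1, Real.norm_of_nonneg hz.2.1]
  exact max_le hz.1.2 hz.2.2

/-- The slice `p = 0` is invisible to `δ₃`, so there the gradient bound is integrated from the base
point, at sup-distance at most 1. For `p ≠ 0`, `|2πp| ≥ 1` and `δ₃` alone suffices. -/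
theorem norm_lift_le (φ : saPart c) (h : lift (φ : Sc c) 0 0 = 0) (p : ℤ) {z : ℝ × ℝ}
    (hz : z ∈ square) : ‖lift (φ : Sc c) p z‖ ≤ (2 + c) * lipL c φ := by
  have h0 : 0 ≤ lipL c φ := apply_nonneg _ _
  by_cases hp : p = 0
  · subst hp
    have := norm_lift_sub_le φ 0 hz zero_mem_square
    rw [h, sub_zero] at this
    exact this.trans (mul_le_of_le_one_right (by positivity) (norm_sub_le_of_mem_square hz))
  · have h3 := ((memS φ).rapid_delta3.norm_le_norm1 (z.1, (z.2 : UnitAddCircle), p)).trans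
      (norm1_delta3_le φ)
    rw [norm_delta3] at h3
    have hp1 : (1 : ℝ) ≤ |(p : ℝ)| := by exact_mod_cast Int.one_le_abs hp
    have h4 : (1 : ℝ) ≤ 2 * Real.pi * |(p : ℝ)| := by nlinarith [Real.pi_gt_three]
    refine ((le_mul_of_one_le_left (norm_nonneg _) h4).trans h3).trans
      (le_mul_of_one_le_left h0 ?_)
    have : (0 : ℝ) ≤ c := Nat.cast_nonneg c
    linarith

/-- The `‖·‖_{∞,∞,1}`-norm is controlled by finitely many slices and `δ₃`. -/
theorem norm1_le_of_slices (φ : saPart c) {N : ℕ} (hN : 0 < N) {η : ℝ}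
    (h : ∀ p ∈ Finset.Icc (-(N : ℤ)) N, ∀ z ∈ square, ‖lift (φ : Sc c) p z‖ ≤ η) :
    norm1 (φ : Sc c) ≤ (2 * N + 1) * η + lipL c φ / N := by
  have hN' : (0 : ℝ) < N := by exact_mod_cast hN
  have hR := (memS φ).rapid_delta3
  -- The majorant is `η` on the `2N + 1` central slices plus `N⁻¹` times the slices of `δ₃φ` for all
  -- `p`. The latter dominates the tail because `N ≤ |p| ≤ 2π|p|` there.
  have h1 : HasSum (fun p : ℤ => if p ∈ Finset.Icc (-(N : ℤ)) N then η else 0)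
      (∑ p ∈ Finset.Icc (-(N : ℤ)) N, if p ∈ Finset.Icc (-(N : ℤ)) N then η else 0) :=
    hasSum_sum_of_ne_finset_zero fun p hp => if_neg hp
  have h2 := h1.add (hR.summable.hasSum.mul_left (N : ℝ)⁻¹)
  have hsum : (∑ p ∈ Finset.Icc (-(N : ℤ)) N, if p ∈ Finset.Icc (-(N : ℤ)) N then η else 0) =
      (2 * N + 1) * η := by
    rw [Finset.sum_ite_mem, Finset.inter_self, Finset.sum_const, Int.card_Icc, nsmul_eq_mul]
    congr 1
    rw [← Int.cast_natCast, Int.toNat_of_nonneg (by omega)]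
    push_cast
    ring
  refine (hasSum_le (fun p => ?_) (memS φ).rapid.summable.hasSum h2).trans ?_
  · refine ciSup_le fun w => ?_
    obtain ⟨z, hz, hwz⟩ := (memS φ).exists_square w.1 w.2 p
    by_cases hp : p ∈ Finset.Icc (-(N : ℤ)) N
    · rw [if_pos hp, hwz]
      exact (h p hp z hz).trans
        (le_add_of_nonneg_right (mul_nonneg (by positivity) (supSlice_nonneg _ _)))
    · rw [if_neg hp, zero_add, le_inv_mul_iff₀ hN']
      refine le_trans ?_ (hR.le_supSlice w.1 w.2 p)
      rw [norm_delta3]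
      refine mul_le_mul_of_nonneg_right ?_ (norm_nonneg _)
      have hp1 : (N : ℝ) ≤ |(p : ℝ)| := by
        have : (N : ℤ) ≤ |p| := by
          rw [Finset.mem_Icc, ← abs_le] at hp
          omega
        exact_mod_cast this
      change (N : ℝ) ≤ 2 * Real.pi * |(p : ℝ)|
      nlinarith [Real.pi_gt_three, abs_nonneg (p : ℝ)]
  · rw [hsum]
    refine add_le_add le_rfl ?_
    rw [div_eq_inv_mul]
    exact mul_le_mul_of_nonneg_left (norm1_delta3_le φ) (by positivity)

/-! ### Normalisation modulo the unit, kernel of `L`, finite net -/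

theorem lipL_unit : lipL c (unit c) = 0 := by
  have h1 : delta1 unitFun = 0 := by ext z; simp [delta1, dx_unitFun]
  have h2 : delta2 c unitFun = 0 := by
    ext z; by_cases hp : z.2.2 = 0 <;> simp [delta2, dy_unitFun, unitFun, hp]
  have h3 : delta3 unitFun = 0 := by
    ext z; by_cases hp : z.2.2 = 0 <;> simp [delta3, unitFun, hp]
  have h0 : norm1 0 = 0 := by simp [norm1, supSlice]
  change max (max (norm1 (delta1 unitFun)) (norm1 (delta2 c unitFun))) (norm1 (delta3 unitFun)) = 0
  simp [h1, h2, h3, h0]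

/-- Subtracting the multiple of the unit that makes the value at the base point vanish. -/
noncomputable def center (φ : saPart c) : saPart c := φ + (-(lift (φ : Sc c) 0 0).re) • unit c

/-- Self-adjointness makes the slice `p = 0` real-valued, so removing a real multiple of the unit is
enough. -/
theorem lift_center (φ : saPart c) : lift (center φ : Sc c) 0 0 = 0 := by
  have h : invol (φ : Sc c) = (φ : Sc c) := φ.2
  have h1 : conj (lift (φ : Sc c) 0 0) = lift (φ : Sc c) 0 0 := congrFun h (0, 0, 0)
  change lift (φ : Sc c) 0 0 + ((-(lift (φ : Sc c) 0 0).re : ℝ) : ℂ) * 1 = 0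
  rw [Complex.ofReal_neg, Complex.conj_eq_iff_re.1 h1]
  ring

theorem lipL_center_le (φ : saPart c) : lipL c (center φ) ≤ lipL c φ := by
  refine (map_add_le_add _ _ _).trans ?_
  rw [map_smul_eq_mul, lipL_unit, mul_zero, add_zero]

theorem lipL_eq_zero_iff (φ : saPart c) : lipL c φ = 0 ↔ ∃ r : ℝ, φ = r • unit c := by
  constructor
  · intro h
    refine ⟨(lift (φ : Sc c) 0 0).re, Subtype.ext (Subtype.ext (funext fun z => ?_))⟩
    obtain ⟨w, hw, e⟩ := (memS (center φ)).exists_square z.1 z.2.1 z.2.2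
    have h1 := norm_lift_le (center φ) (lift_center φ) z.2.2 hw
    -- `L` of the centred element is 0, so `norm_lift_le` makes all its slices vanish.
    rw [le_antisymm ((lipL_center_le φ).trans h.le) (apply_nonneg _ _), mul_zero, ← e,
      norm_le_zero_iff] at h1
    have h2 : (φ : Sc c).1 z + ((-(lift (φ : Sc c) 0 0).re : ℝ) : ℂ) * unitFun z = 0 := h1
    rw [Complex.ofReal_neg, neg_mul, add_neg_eq_zero] at h2
    exact h2
  · rintro ⟨r, rfl⟩
    rw [map_smul_eq_mul, lipL_unit, mul_zero]

/-- The unit ball of `L` is totally bounded for `‖·‖_{∞,∞,1}`, modulo multiples of the unit. -/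
theorem exists_finite_net {ε : ℝ} (hε : 0 < ε) : ∃ F : Set (saPart c), F.Finite ∧
    ∀ a, lipL c a ≤ 1 → ∃ b ∈ F, ∃ r : ℝ, norm1 ((a - b - r • unit c : saPart c) : Sc c) ≤ ε := by
  -- A difference of two elements of the ball has `L ≤ 2`, so its tail `2 / N` is at most `ε / 2`.
  -- The choice of `η` makes the `2N + 1` central slices contribute another `ε / 2`, and `δ` makes
  -- the oscillation `2(2 + c)δ` between grid points equal to `η / 2`.
  obtain ⟨N, hN⟩ := exists_nat_gt (4 / ε)
  have hN0 : (0 : ℝ) < N := (by positivity : (0 : ℝ) < 4 / ε).trans hN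
  have hNpos : 0 < N := by exact_mod_cast hN0
  let η : ℝ := ε / (2 * (2 * N + 1))
  have hη : 0 < η := by positivity
  let δ : ℝ := η / (4 * (2 + c))
  have hδ : 0 < δ := by positivity
  obtain ⟨G, hGs, hG, hcov⟩ := (isCompact_Icc.prod isCompact_Icc :
    IsCompact square).finite_cover_balls hδ
  let J : Finset (ℤ × (ℝ × ℝ)) := Finset.Icc (-(N : ℤ)) N ×ˢ hG.toFinset
  let S : saPart c → J → ℂ := fun φ j => lift (φ : Sc c) j.1.1 j.1.2
  let B : Set (saPart c) := {φ | lipL c φ ≤ 1 ∧ lift (φ : Sc c) 0 0 = 0}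
  -- Sampling the slices on the grid maps the normalised ball to a bounded set in a
  -- finite-dimensional space.
  have hS : TotallyBounded (S '' B) := by
    refine (isCompact_closedBall (0 : J → ℂ) (2 + c)).totallyBounded.subset ?_
    rintro _ ⟨φ, ⟨h1, h0⟩, rfl⟩
    rw [mem_closedBall_zero_iff, pi_norm_le_iff_of_nonneg (by positivity)]
    rintro ⟨⟨p, z⟩, hj⟩
    have hz : z ∈ G := by simpa using (Finset.mem_product.1 hj).2
    refine (norm_lift_le φ h0 p (hGs hz)).trans ?_
    exact mul_le_of_le_one_right (by positivity) h1
  -- The centres of the net are taken in the image of `B`, so that `L b ≤ 1` holds for each `b` in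
  -- `F`.
  obtain ⟨F, hFB, hF, hFcov⟩ := Set.exists_subset_image_finite_and.1
    (Metric.finite_approx_of_totallyBounded hS (η / 2) (by positivity))
  refine ⟨F, hF, fun a ha => ?_⟩
  have haB : center a ∈ B := ⟨(lipL_center_le a).trans ha, lift_center a⟩
  obtain ⟨_, ⟨b, hb, rfl⟩, hab⟩ := Set.mem_iUnion₂.1 (hFcov ⟨_, haB, rfl⟩)
  refine ⟨b, hb, (lift (a : Sc c) 0 0).re, ?_⟩
  have e : a - b - (lift (a : Sc c) 0 0).re • unit c = center a + (-1 : ℝ) • b := by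
    refine Subtype.ext (Subtype.ext (funext fun z => ?_))
    change (a : Sc c).1 z - (b : Sc c).1 z - ((lift (a : Sc c) 0 0).re : ℂ) * unitFun z =
      (a : Sc c).1 z + ((-(lift (a : Sc c) 0 0).re : ℝ) : ℂ) * unitFun z +
        ((-1 : ℝ) : ℂ) * (b : Sc c).1 z
    push_cast
    ring
  rw [e]
  let h : saPart c := center a + (-1 : ℝ) • b
  have hL : lipL c h ≤ 2 := by
    refine (map_add_le_add _ _ _).trans ?_
    rw [map_smul_eq_mul, norm_neg, norm_one, one_mul]
    linarith [haB.1, (hFB hb).1]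
  have hval : ∀ p z, lift (h : Sc c) p z =
      lift (center a : Sc c) p z - lift (b : Sc c) p z := fun p z => by
    change lift (center a : Sc c) p z + ((-1 : ℝ) : ℂ) * lift (b : Sc c) p z = _
    push_cast
    ring
  refine (norm1_le_of_slices h hNpos (η := η) fun p hp z hz => ?_).trans ?_
  -- Half of `η` comes from the value at the nearby grid point `g`, half from the Lipschitz bound
  -- between `z` and `g`.
  · obtain ⟨g, hg, hzg⟩ := Set.mem_iUnion₂.1 (hcov hz)
    have h1 : ‖lift (h : Sc c) p g‖ < η / 2 := by
      have hj : (p, g) ∈ J := Finset.mem_product.2 ⟨hp, hG.mem_toFinset.2 hg⟩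
      rw [hval, ← dist_eq_norm]
      exact (dist_le_pi_dist (S (center a)) (S b) ⟨(p, g), hj⟩).trans_lt hab
    have h2 := norm_lift_sub_le h p hz (hGs hg)
    have h3 : (2 + c) * lipL c h * ‖z - g‖ ≤ (2 + c) * 2 * δ := by
      rw [Metric.mem_ball, dist_eq_norm] at hzg
      gcongr
    have h4 : (2 + c) * 2 * δ = η / 2 := by
      simp only [δ]
      field_simp
      norm_num
    have h5 := norm_sub_norm_le (lift (h : Sc c) p z) (lift (h : Sc c) p g)
    linarith
  · have h1 : (2 * N + 1) * η = ε / 2 := by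
      simp only [η]
      field_simp
    have h2 : lipL c h / N ≤ ε / 2 := by
      rw [div_le_iff₀ hN0]
      rw [div_lt_iff₀ hε] at hN
      linarith
    linarith

end Compactness

end QHM

theorem mainTheorem1 (c : ℕ) (hc : 0 < c) (hb mu nu : ℝ) (hmn : mu ^ 2 + nu ^ 2 ≠ 0) :
    IsCompactQuantumMetricSpace (QHM.le c hb mu nu) (QHM.unit c) (QHM.lipL c) :=
  ⟨QHM.isOrderUnitSpace hb mu nu, IsLipNorm.of_finite_net (QHM.abs_state_le hb mu nu)
    QHM.lipL_eq_zero_iff fun _ hε => QHM.exists_finite_net hε⟩
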